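/- Let $n\ge 2$ and $1\le k\le n$ be integers. Let $\Theta_k$ be the set of matrices $\theta\in[0,1]^{n\times n}$ with $\theta_{ii}=0$ for all $i$ for which there are a symmetric matrix $Q\in[0,1]^{k\times k}$ and a map $z:\{1,\dots,n\}\to\{1,\dots,k\}$ such that $\theta_{ij}=Q_{z(i)z(j)}$ for all $i\ne j$. In the stochastic block model with connectivity matrix $\theta\in\Theta_k$ one observes a random adjacency matrix $A\in\{0,1\}^{n\times n}$ whose entries $A_{ij}$, $1\le j<i\le n$, are independent with $A_{ij}\sim\mathrm{Bernoulli}(\theta_{ij})$, and $A_{ji}=A_{ij}$, $A_{ii}=0$; write $\mathbb E_\theta$ for the expectation under this law. Theorem 1.1. There is a universal constant $C>0$ such that for all integers $n\ge2$ and $1\le k\le n$, $$C^{-1}\Bigl(\frac{k^2}{n^2}+\frac{\log k}{n}\Bigr)\;\le\;\inf_{\hat\theta}\,\sup_{\theta\in\Theta_k}\mathbb E_\theta\Bigl\{\frac1{n^2}\sum_{i,j=1}^n(\hat\theta_{ij}-\theta_{ij})^2\Bigr\}\;\le\;C\Bigl(\frac{k^2}{n^2}+\frac{\log k}{n}\Bigr),$$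 where the infimum is over all estimators $\hat\theta=\hat\theta(A)\in\mathbb R^{n\times n}$. -/

import Mathlib

open scoped ENNReal

noncomputable section

namespace SBM

/-- The parameter space `Θ_k` of connectivity matrices `θ ∈ [0,1]^{n×n}` with `k` clusters: the
diagonal of `θ` vanishes and, off the diagonal, `θ i j = Q (z i) (z j)` for some symmetric
`Q ∈ [0,1]^{k×k}` and some assignment `z : [n] → [k]` (clusters may be empty). -/
def paramSpace (n k : ℕ) : Set (Matrix (Fin n) (Fin n) unitInterval) :=
  {θ | (∀ i, θ i i = 0) ∧
    ∃ (Q : Matrix (Fin k) (Fin k) unitInterval) (z : Fin n → Fin k),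
      (∀ a b, Q a b = Q b a) ∧ ∀ i j, i ≠ j → θ i j = Q (z i) (z j)}

/-- The unordered pairs of distinct nodes, listed as pairs `(i, j)` with `j < i`. -/
abbrev Pairs (n : ℕ) : Type := {p : Fin n × Fin n // p.2 < p.1}

/-- A `0`-`1` matrix indexed by the `n` nodes. -/
abbrev AdjMatrix (n : ℕ) : Type := Fin n → Fin n → Fin 2

/-- The adjacency matrix with `A i j = A j i = x (i, j)` for `j < i`, and `A i i = 0`. -/
def toAdjMatrix {n : ℕ} (x : Pairs n → Fin 2) : AdjMatrix n := fun i j =>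
  if h : j < i then x ⟨(i, j), h⟩ else if h : i < j then x ⟨(j, i), h⟩ else 0

/-- The law of the adjacency matrix `A` under the connectivity matrix `θ`: the entries `A i j`,
`j < i`, are independent Bernoulli variables with means `θ i j`, and `A i j = A j i`,
`A i i = 0`. -/
def graphLaw {n : ℕ} (θ : Matrix (Fin n) (Fin n) unitInterval) :
    MeasureTheory.Measure (AdjMatrix n) :=
  (MeasureTheory.Measure.pi fun p : Pairs n =>
    ProbabilityTheory.bernoulliMeasure (1 : Fin 2) 0 (θ p.1.1 p.1.2)).map toAdjMatrix

/-- The normalized squared Frobenius loss `n⁻² ∑_{i,j} (θ̂ i j - θ i j)²`. -/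
def loss {n : ℕ} (θhat : Matrix (Fin n) (Fin n) ℝ) (θ : Matrix (Fin n) (Fin n) unitInterval) : ℝ :=
  1 / (n : ℝ) ^ 2 * ∑ i, ∑ j, (θhat i j - (θ i j : ℝ)) ^ 2

/-- The risk `𝔼_θ loss (θ̂(A), θ)` of the estimator `θ̂`, the loss being nonnegative. -/
def risk {n : ℕ} (θhat : AdjMatrix n → Matrix (Fin n) (Fin n) ℝ)
    (θ : Matrix (Fin n) (Fin n) unitInterval) : ℝ≥0∞ :=
  ∫⁻ A, ENNReal.ofReal (loss (θhat A) θ) ∂(graphLaw θ)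

/-- The minimax risk: the infimum over all estimators `θ̂` (functions of the observed adjacency
matrix; every function on this finite discrete space is measurable) of the worst risk on `Θ_k`. -/
def minimaxRisk (n k : ℕ) : ℝ≥0∞ :=
  ⨅ θhat : AdjMatrix n → Matrix (Fin n) (Fin n) ℝ, ⨆ θ ∈ paramSpace n k, risk θhat θ

end SBM

end

/-! Upper bound: least squares over all labellings. For a fixed labelling the means span a space of
dimension at most `k ^ 2`, and there are `k ^ n` labellings. The error of the fit is at most twice
the norm of the noise projected on the fitted space enlarged by the truth. The squared norm of the
noise projected on a `d`-dimensional space has exponential moment at most `2 ^ d`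
(`sum_bernWeight_exp_proj_le`), so a union bound and Jensen give total squared error of order `n log
k + k ^ 2` (`exists_estimator_sum_sq_le`).

Lower bound: the unknown is a uniformly random word. Even when all other letters are revealed, each
letter is hard to identify, by a chi-square and Cauchy-Schwarz argument
(`sq_sum_bernWeight_selection_le`). Missing it costs a fixed loss on a set of entries of its own, so
the losses add up (`exists_le_risk_of_word_family`). Two families are used. For `k ^ 2`, the letters
are signs perturbing each block mean around `1 / 2` on the scale of the inverse root of the block
size. For `n log k`, the letters are the labels of at least half of the nodes, and the
connectivities are Hadamard signs of amplitude about `√(log k / n)`; distinct Hadamard rows are far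
apart. The larger of the two bounds controls the sum. -/

namespace SBM

open MeasureTheory ProbabilityTheory Real

/-! ### Reduction of the risk to finite sums over pairs -/

section Weight

variable {ι : Type*} [Fintype ι]

/-- The probability of `x` when the coordinates are independent Bernoulli with means `t`. -/
noncomputable def bernWeight (t : ι → ℝ) (x : ι → Fin 2) : ℝ :=
  ∏ p, if x p = 1 then t p else 1 - t p

theorem sum_prod_fin_two [DecidableEq ι] (f : ι → Fin 2 → ℝ) :
    ∑ x : ι → Fin 2, ∏ p, f p (x p) = ∏ p, (f p 0 + f p 1) := by
  have h := Finset.prod_univ_sum (fun _ : ι => (Finset.univ : Finset (Fin 2))) f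
  simp only [Fin.sum_univ_two, Fintype.piFinset_univ] at h
  exact h.symm

theorem bernWeight_nonneg {t : ι → ℝ} (ht : ∀ p, t p ∈ Set.Icc (0 : ℝ) 1) (x : ι → Fin 2) :
    0 ≤ bernWeight t x := by
  refine Finset.prod_nonneg fun p _ => ?_
  have := ht p
  split_ifs
  · exact this.1
  · linarith [this.2]

theorem sum_bernWeight [DecidableEq ι] (t : ι → ℝ) : ∑ x, bernWeight t x = 1 := by
  unfold bernWeight
  rw [sum_prod_fin_two (fun p v => if v = 1 then t p else 1 - t p)]
  simp

end Weight

/-- The two-valued matrix is recovered from its entries below the diagonal. -/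
theorem toAdjMatrix_apply_pair {n : ℕ} (x : Pairs n → Fin 2) (p : Pairs n) :
    toAdjMatrix x p.1.1 p.1.2 = x p := by
  simp [toAdjMatrix, p.2]

theorem risk_eq_sum {n : ℕ} (θhat : AdjMatrix n → Matrix (Fin n) (Fin n) ℝ)
    (θ : Matrix (Fin n) (Fin n) unitInterval) :
    risk θhat θ = ENNReal.ofReal (∑ x, bernWeight (fun p : Pairs n => (θ p.1.1 p.1.2 : ℝ)) x *
      loss (θhat (toAdjMatrix x)) θ) := by
  have hl : ∀ A, 0 ≤ loss (θhat A) θ := fun A => by unfold loss; positivity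
  have hw := bernWeight_nonneg (fun p : Pairs n => (θ p.1.1 p.1.2).2)
  unfold risk graphLaw
  rw [lintegral_map (measurable_of_countable _) (measurable_of_countable _), lintegral_fintype,
    ENNReal.ofReal_sum_of_nonneg fun x _ => mul_nonneg (hw x) (hl _)]
  refine Finset.sum_congr rfl fun x _ => ?_
  rw [ENNReal.ofReal_mul (hw x), mul_comm, Measure.pi_singleton]
  congr 1
  unfold bernWeight
  rw [ENNReal.ofReal_prod_of_nonneg]
  · refine Finset.prod_congr rfl fun p _ => ?_
    rcases Fin.exists_fin_two.1 ⟨x p, rfl⟩ with h | h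
    · rw [h, bernoulliMeasure_apply_of_notMem_of_mem _ (measurableSet_singleton _) (by simp)
        (by simp), if_neg (by simp), ENNReal.ofReal]
      congr 1
      ext
      have := (θ p.1.1 p.1.2).2.2
      simp [this]
    · rw [h, bernoulliMeasure_apply_of_mem_of_notMem _ (measurableSet_singleton _) (by simp)
        (by simp), if_pos rfl, ENNReal.ofReal]
      congr 1
      ext
      have := (θ p.1.1 p.1.2).2.1
      simp [this]
  · intro p _
    have := (θ p.1.1 p.1.2).2
    split_ifs
    · exact this.1
    · linarith [this.2]

/-- A sum over all ordered pairs, split into the diagonal and the two triangles. -/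
theorem sum_sum_eq_pairs {n : ℕ} (f : Fin n → Fin n → ℝ) :
    ∑ i, ∑ j, f i j = ∑ i, f i i + ∑ p : Pairs n, (f p.1.1 p.1.2 + f p.1.2 p.1.1) := by
  have h1 : ∑ p : Pairs n, f p.1.1 p.1.2 = ∑ i, ∑ j, if j < i then f i j else 0 := by
    rw [← Fintype.sum_prod_type' (f := fun i j => if j < i then f i j else 0),
      ← Finset.sum_filter]
    exact (Finset.sum_subtype _ (by simp) (fun p : Fin n × Fin n => f p.1 p.2)).symm
  have h2 : ∑ p : Pairs n, f p.1.2 p.1.1 = ∑ i, ∑ j, if i < j then f i j else 0 := by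
    rw [Finset.sum_comm, ← Fintype.sum_prod_type' (f := fun j i => if i < j then f i j else 0),
      ← Finset.sum_filter]
    exact (Finset.sum_subtype _ (by simp) (fun p : Fin n × Fin n => f p.2 p.1)).symm
  have h3 : ∑ i, f i i = ∑ i, ∑ j, if i = j then f i j else 0 := by simp
  rw [Finset.sum_add_distrib, h1, h2, h3]
  simp only [← Finset.sum_add_distrib]
  refine Finset.sum_congr rfl fun i _ => Finset.sum_congr rfl fun j _ => ?_
  rcases lt_trichotomy i j with h | h | h
  · simp [h, h.ne, h.not_gt]
  · simp [h]
  · simp [h, h.ne', h.not_gt]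

theorem two_mul_card_pairs (n : ℕ) : 2 * (Fintype.card (Pairs n) : ℝ) = n * (n - 1) := by
  have h := sum_sum_eq_pairs (n := n) (fun _ _ => (1 : ℝ))
  simp at h
  linarith

/-- A lower bound on the minimax risk from a lower bound on the worst risk over the pairs. -/
theorem le_minimaxRisk {n k : ℕ} {v : ℝ}
    (h : ∀ est : (Pairs n → Fin 2) → Pairs n → ℝ, ∃ θ ∈ paramSpace n k,
      v ≤ ∑ x, bernWeight (fun p : Pairs n => (θ p.1.1 p.1.2 : ℝ)) x *
        ∑ p, (est x p - (θ p.1.1 p.1.2 : ℝ)) ^ 2) :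
    ENNReal.ofReal (1 / (n : ℝ) ^ 2 * v) ≤ minimaxRisk n k := by
  refine le_iInf fun θhat => ?_
  obtain ⟨θ, hθ, hv⟩ := h fun x p => θhat (toAdjMatrix x) p.1.1 p.1.2
  refine le_trans ?_ (le_iSup₂ (f := fun θ (_ : θ ∈ paramSpace n k) => risk θhat θ) θ hθ)
  rw [risk_eq_sum]
  refine ENNReal.ofReal_le_ofReal ((mul_le_mul_of_nonneg_left hv (by positivity)).trans ?_)
  rw [Finset.mul_sum]
  refine Finset.sum_le_sum fun x _ => ?_
  rw [mul_left_comm]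
  refine mul_le_mul_of_nonneg_left ?_ (bernWeight_nonneg (fun p : Pairs n => (θ p.1.1 p.1.2).2) x)
  unfold loss
  refine mul_le_mul_of_nonneg_left ?_ (by positivity)
  rw [sum_sum_eq_pairs, Finset.sum_add_distrib]
  have h1 : 0 ≤ ∑ i, (θhat (toAdjMatrix x) i i - (θ i i : ℝ)) ^ 2 := by positivity
  have h2 : 0 ≤ ∑ p : Pairs n, (θhat (toAdjMatrix x) p.1.2 p.1.1 - (θ p.1.2 p.1.1 : ℝ)) ^ 2 := by
    positivity
  linarith

/-- An upper bound on the minimax risk from an estimator of the entries below the diagonal. -/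
theorem minimaxRisk_le {n k : ℕ} {v : ℝ} (est : (Pairs n → Fin 2) → Pairs n → ℝ)
    (h : ∀ θ ∈ paramSpace n k,
      ∑ x, bernWeight (fun p : Pairs n => (θ p.1.1 p.1.2 : ℝ)) x *
        ∑ p, (est x p - (θ p.1.1 p.1.2 : ℝ)) ^ 2 ≤ v) :
    minimaxRisk n k ≤ ENNReal.ofReal (2 / (n : ℝ) ^ 2 * v) := by
  -- Symmetric completion with zero diagonal: since `θ` has the same shape, the loss over the pairs
  -- exactly doubles.
  refine iInf_le_of_le (fun A => Matrix.of fun i j =>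
    if h : j < i then est (fun p => A p.1.1 p.1.2) ⟨(i, j), h⟩
    else if h : i < j then est (fun p => A p.1.1 p.1.2) ⟨(j, i), h⟩ else 0) ?_
  refine iSup₂_le fun θ hθ => ?_
  rw [risk_eq_sum]
  refine ENNReal.ofReal_le_ofReal (le_trans (le_of_eq ?_)
    (mul_le_mul_of_nonneg_left (h θ hθ) (by positivity)))
  rw [Finset.mul_sum]
  refine Finset.sum_congr rfl fun x _ => ?_
  rw [mul_left_comm]
  congr 1
  unfold loss
  rw [sum_sum_eq_pairs, show 2 / (n : ℝ) ^ 2 = 1 / (n : ℝ) ^ 2 * 2 by ring, mul_assoc]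
  congr 1
  have hsymm : ∀ i j, θ i j = θ j i := by
    obtain ⟨-, Q, z, hQ, hz⟩ := hθ
    intro i j
    rcases eq_or_ne i j with rfl | hij
    · rfl
    · rw [hz i j hij, hz j i hij.symm, hQ]
  have hd : ∀ i, (θ i i : ℝ) = 0 := fun i => by rw [hθ.1 i]; rfl
  simp only [Matrix.of_apply, lt_irrefl, dite_false, hd, sub_zero, ne_eq, OfNat.ofNat_ne_zero, not_false_eq_true,
    zero_pow, Finset.sum_const_zero, zero_add, toAdjMatrix_apply_pair, Finset.mul_sum]
  refine Finset.sum_congr rfl fun p _ => ?_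
  rw [dif_pos p.2, dif_neg (not_lt.2 p.2.le), dif_pos p.2, hsymm p.1.2 p.1.1]
  ring

/-! ### Exponential moments of projected Bernoulli noise -/

/-- Hoeffding's lemma for a centered Bernoulli variable. -/
theorem bernoulli_mgf_le {t : ℝ} (ht : t ∈ Set.Icc (0 : ℝ) 1) (c : ℝ) :
    (1 - t) * exp (c * (0 - t)) + t * exp (c * (1 - t)) ≤ exp (c ^ 2 / 8) := by
  let μ := bernoulliMeasure (1 : ℝ) 0 ⟨t, ht⟩
  have hb : ∀ᵐ ω ∂μ, id ω ∈ Set.Icc (0 : ℝ) 1 := by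
    rw [ae_iff]
    exact bernoulliMeasure_apply_of_notMem_of_notMem _ (measurableSet_Icc.compl) (by simp)
      (by simp)
  have h := (hasSubgaussianMGF_of_mem_Icc (μ := μ) aemeasurable_id hb).mgf_le c
  simp only [mgf, μ, integral_bernoulliMeasure] at h
  simp at h
  convert h using 1
  · simp; ring
  · congr 1; ring

section

variable {ι : Type*} [Fintype ι]

/-- The zero-one observations as a real vector. -/
noncomputable def obs (x : ι → Fin 2) (p : ι) : ℝ := if x p = 1 then 1 else 0

theorem sum_bernWeight_exp_le [DecidableEq ι] {t : ι → ℝ} (ht : ∀ p, t p ∈ Set.Icc (0 : ℝ) 1)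
    (c : ι → ℝ) :
    ∑ x, bernWeight t x * exp (∑ p, c p * (obs x p - t p)) ≤ exp ((∑ p, c p ^ 2) / 8) := by
  simp only [Real.exp_sum, bernWeight, ← Finset.prod_mul_distrib, obs]
  rw [sum_prod_fin_two (fun p v => (if v = 1 then t p else 1 - t p) *
    exp (c p * ((if v = 1 then 1 else 0) - t p))), Finset.sum_div, Real.exp_sum]
  refine Finset.prod_le_prod (fun p _ => ?_) fun p _ => ?_
  · have h1 := (ht p).1
    have h2 := (ht p).2
    have h3 : 0 ≤ 1 - t p := by linarith
    simp only [Fin.isValue, zero_ne_one, if_false, if_true]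
    positivity
  · simpa using bernoulli_mgf_le (ht p) (c p)

theorem gaussianPDFReal_mul_exp_sq (g : ℝ) :
    gaussianPDFReal 0 1 g * exp (g ^ 2 / 8) = (√(2 * π))⁻¹ * exp (-(3 / 8) * g ^ 2) := by
  simp only [gaussianPDFReal, sub_zero, NNReal.coe_one, mul_one]
  rw [mul_assoc, ← exp_add]
  congr 2
  ring

/-- The exact value is `2 / √3`; the bound `2` is only a convenient one. -/
theorem integral_exp_sq_gaussian_le : ∫ g, exp (g ^ 2 / 8) ∂(gaussianReal 0 1) ≤ 2 := by
  rw [integral_gaussianReal_eq_integral_smul one_ne_zero]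
  simp only [smul_eq_mul, gaussianPDFReal_mul_exp_sq]
  rw [integral_const_mul, integral_gaussian, inv_mul_le_iff₀ (by positivity)]
  rw [Real.sqrt_le_left (by positivity), mul_pow, Real.sq_sqrt (by positivity)]
  have := Real.pi_pos
  field_simp
  norm_num

theorem integrable_exp_sq_gaussian : Integrable (fun g => exp (g ^ 2 / 8)) (gaussianReal 0 1) := by
  rw [gaussianReal_of_var_ne_zero _ one_ne_zero]
  rw [integrable_withDensity_iff_integrable_smul₀' (by fun_prop) (by simp [gaussianPDF])]
  simp only [gaussianPDF, smul_eq_mul, ENNReal.toReal_ofReal (gaussianPDFReal_nonneg _ _ _),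
    gaussianPDFReal_mul_exp_sq]
  exact (integrable_exp_neg_mul_sq (by norm_num)).const_mul _

/-- Linearizes a square in the exponent: an auxiliary Gaussian `g` reduces quadratic exponential
moments to the linear ones of `sum_bernWeight_exp_le`. -/
theorem exp_sq_eq_integral_gaussian (s : ℝ) :
    exp (s ^ 2 / 2) = ∫ g, exp (s * g) ∂(gaussianReal 0 1) := by
  have h := congrFun (mgf_id_gaussianReal (μ := 0) (v := 1)) s
  simp [mgf] at h
  exact h.symm

/-- Exponential moments of a sum of squares of `d` linear forms of independent centered Bernoulli
variables, the coefficient vectors being orthonormal. -/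
theorem sum_bernWeight_exp_sum_sq_le [DecidableEq ι] {t : ι → ℝ}
    (ht : ∀ p, t p ∈ Set.Icc (0 : ℝ) 1) {d : ℕ} (v : Fin d → ι → ℝ)
    (hv : ∀ g : Fin d → ℝ, ∑ p, (∑ i, g i * v i p) ^ 2 ≤ ∑ i, g i ^ 2) :
    ∑ x, bernWeight t x * exp ((∑ i, (∑ p, v i p * (obs x p - t p)) ^ 2) / 2) ≤ 2 ^ d := by
  let γ : Measure (Fin d → ℝ) := Measure.pi fun _ => gaussianReal 0 1
  have key : ∀ s : Fin d → ℝ, exp ((∑ i, s i ^ 2) / 2) = ∫ g, exp (∑ i, s i * g i) ∂γ := by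
    intro s
    simp only [Finset.sum_div, Real.exp_sum, exp_sq_eq_integral_gaussian]
    exact (integral_fintype_prod_eq_prod (fun i y => exp (s i * y))).symm
  have hint : ∀ s : Fin d → ℝ, Integrable (fun g => exp (∑ i, s i * g i)) γ := by
    intro s
    simp only [Real.exp_sum]
    exact Integrable.fintype_prod (f := fun i y => exp (s i * y))
      fun i => integrable_exp_mul_gaussianReal (s i)
  have hint2 : Integrable (fun g : Fin d → ℝ => ∏ i, exp (g i ^ 2 / 8)) γ :=
    Integrable.fintype_prod (f := fun _ y => exp (y ^ 2 / 8)) fun _ => integrable_exp_sq_gaussian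
  calc ∑ x, bernWeight t x * exp ((∑ i, (∑ p, v i p * (obs x p - t p)) ^ 2) / 2)
      = ∫ g, ∑ x, bernWeight t x * exp (∑ i, (∑ p, v i p * (obs x p - t p)) * g i) ∂γ := by
        rw [integral_finsetSum _ fun x _ => (hint _).const_mul _]
        simp only [integral_const_mul, key]
    _ ≤ ∫ g, ∏ i, exp (g i ^ 2 / 8) ∂γ := by
        refine integral_mono (integrable_finsetSum _ fun x _ => (hint _).const_mul _) hint2 ?_
        intro g
        have h := sum_bernWeight_exp_le ht fun p => ∑ i, g i * v i p
        simp only [Finset.sum_mul, ← Real.exp_sum, ← Finset.sum_div] at h ⊢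
        refine le_trans (le_of_eq ?_) (h.trans (exp_le_exp.2 (by linarith [hv g])))
        refine Finset.sum_congr rfl fun x _ => ?_
        rw [Finset.sum_comm]
        congr 2
        refine Finset.sum_congr rfl fun p _ => Finset.sum_congr rfl fun i _ => ?_
        ring
    _ = (∫ y, exp (y ^ 2 / 8) ∂(gaussianReal 0 1)) ^ d := by
        rw [integral_fintype_prod_eq_prod (fun _ y => exp (y ^ 2 / 8))]
        simp
    _ ≤ 2 ^ d := by
        gcongr
        exact integral_exp_sq_gaussian_le

open Module in
/-- Exponential moments of the squared norm of the projection of the noise on a subspace. -/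
theorem sum_bernWeight_exp_proj_le [DecidableEq ι] {t : ι → ℝ}
    (ht : ∀ p, t p ∈ Set.Icc (0 : ℝ) 1) (L : Submodule ℝ (EuclideanSpace ℝ ι)) :
    ∑ x, bernWeight t x *
      exp (‖L.starProjection (WithLp.toLp 2 fun p => obs x p - t p)‖ ^ 2 / 2)
      ≤ 2 ^ finrank ℝ L := by
  let e := stdOrthonormalBasis ℝ L
  have h := sum_bernWeight_exp_sum_sq_le ht (fun i p => (e i : EuclideanSpace ℝ ι) p) ?_
  · refine le_trans (le_of_eq ?_) h
    refine Finset.sum_congr rfl fun x _ => ?_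
    congr 3
    set w : EuclideanSpace ℝ ι := WithLp.toLp 2 fun p => obs x p - t p with hw
    rw [Submodule.starProjection_apply, ← Submodule.coe_norm,
      ← e.sum_sq_norm_inner_right (L.orthogonalProjectionOnto w)]
    refine Finset.sum_congr rfl fun i _ => ?_
    rw [Submodule.inner_orthogonalProjectionOnto_eq_of_mem_left, Real.norm_eq_abs, sq_abs]
    congr 1
    simp [PiLp.inner_apply, hw, mul_comm]
  · intro g
    have h1 : ‖∑ i, g i • e i‖ ^ 2 = ∑ i, g i ^ 2 := by
      rw [← real_inner_self_eq_norm_sq, e.orthonormal.inner_sum]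
      simp [sq]
    rw [← h1, Submodule.coe_norm, EuclideanSpace.norm_sq_eq]
    simp
end

/-! ### Least squares and the upper bound -/

theorem norm_sub_starProjection_le {E : Type*} [NormedAddCommGroup E] [InnerProductSpace ℝ E]
    (L : Submodule ℝ E) [L.HasOrthogonalProjection] (y : E) {u : E} (hu : u ∈ L) :
    ‖y - L.starProjection y‖ ≤ ‖y - u‖ := by
  rw [Submodule.starProjection_minimal]
  exact ciInf_le ⟨0, by rintro _ ⟨v, rfl⟩; positivity⟩ (⟨u, hu⟩ : L)

/-- If `u ∈ L` fits `y` at least as well as `θ ∈ L` does, then `u` is within twice the projected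
noise of `θ`. -/
theorem norm_sub_sq_le_of_norm_sub_le {E : Type*} [NormedAddCommGroup E] [InnerProductSpace ℝ E]
    (L : Submodule ℝ E) [L.HasOrthogonalProjection] {y u θ : E} (hu : u ∈ L) (hθ : θ ∈ L)
    (h : ‖y - u‖ ≤ ‖y - θ‖) :
    ‖u - θ‖ ^ 2 ≤ 4 * ‖L.starProjection (y - θ)‖ ^ 2 := by
  have h1 : ‖y - u‖ ^ 2 = ‖y - θ‖ ^ 2 - 2 * inner ℝ (y - θ) (u - θ) + ‖u - θ‖ ^ 2 := by
    rw [← norm_sub_sq_real, sub_sub_sub_cancel_right]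
  have h2 : inner ℝ (y - θ) (u - θ) = inner ℝ (L.starProjection (y - θ)) (u - θ) := by
    rw [Submodule.inner_starProjection_left_eq_right,
      Submodule.starProjection_eq_self_iff.2 (L.sub_mem hu hθ)]
  have h3 := real_inner_le_norm (L.starProjection (y - θ)) (u - θ)
  have h4 : ‖y - u‖ ^ 2 ≤ ‖y - θ‖ ^ 2 := by gcongr
  have h5 : ‖u - θ‖ ≤ 2 * ‖L.starProjection (y - θ)‖ := by
    rcases (norm_nonneg (u - θ)).eq_or_lt with h0 | h0
    · rw [← h0]; positivity
    · nlinarith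
  nlinarith [norm_nonneg (u - θ)]

/-- Jensen for `exp`: turns an exponential moment into a bound on the mean, so that the cardinality
of a union bound enters through its logarithm. -/
theorem sum_mul_le_log {X : Type*} [Fintype X] {w f : X → ℝ} (hw : ∀ x, 0 ≤ w x)
    (h1 : ∑ x, w x = 1) {B : ℝ} (hB : ∑ x, w x * exp (f x) ≤ B) : ∑ x, w x * f x ≤ log B := by
  have h := convexOn_exp.map_sum_le (t := Finset.univ) (w := w) (p := f) (fun x _ => hw x) h1
    fun x _ => Set.mem_univ _
  simp only [smul_eq_mul] at h
  exact (le_log_iff_exp_le ((exp_pos _).trans_le (h.trans hB))).2 (h.trans hB)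

open Module in
/-- Least squares over a finite union of spaces of vectors that are constant on the fibers of a
labelling: the risk is at most the log-cardinality plus the dimension, up to a constant. -/
theorem exists_estimator_sum_sq_le {ι Z β : Type*} [Fintype ι] [DecidableEq ι] [Fintype Z]
    [Nonempty Z] [Fintype β] (b : Z → ι → β) :
    ∃ est : (ι → Fin 2) → ι → ℝ, ∀ t : ι → ℝ, (∀ p, t p ∈ Set.Icc (0 : ℝ) 1) →
      (∃ z, ∃ Q : β → ℝ, ∀ p, t p = Q (b z p)) →
      ∑ x, bernWeight t x * ∑ p, (est x p - t p) ^ 2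
        ≤ 8 * (log (Fintype.card Z) + (Fintype.card β + 1)) := by
  let V : Z → (β → ℝ) →ₗ[ℝ] EuclideanSpace ℝ ι := fun z =>
    (WithLp.linearEquiv 2 ℝ (ι → ℝ)).symm.toLinearMap ∘ₗ LinearMap.funLeft ℝ ℝ (b z)
  let L : Z → Submodule ℝ (EuclideanSpace ℝ ι) := fun z => LinearMap.range (V z)
  let Y : (ι → Fin 2) → EuclideanSpace ℝ ι := fun x => WithLp.toLp 2 (obs x)
  have hmin : ∀ x, ∃ z, ∀ z', ‖Y x - (L z).starProjection (Y x)‖ ≤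
      ‖Y x - (L z').starProjection (Y x)‖ := fun x => by
    simpa using Finset.exists_min_image Finset.univ
      (fun z => ‖Y x - (L z).starProjection (Y x)‖) Finset.univ_nonempty
  choose zhat hzhat using hmin
  refine ⟨fun x p => (L (zhat x)).starProjection (Y x) p, ?_⟩
  rintro t ht ⟨z₀, Q, hQ⟩
  set θ : EuclideanSpace ℝ ι := WithLp.toLp 2 t with hθ
  have hθL : θ ∈ L z₀ := by
    refine ⟨Q, ?_⟩
    ext p
    simp [V, hθ, hQ, LinearMap.funLeft]
  -- The truth need not lie in the fitted space. Adjoining it costs one dimension and keeps each `M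
  -- z` independent of the observations.
  let M : Z → Submodule ℝ (EuclideanSpace ℝ ι) := fun z => L z ⊔ Submodule.span ℝ {θ}
  have hM : ∀ z, finrank ℝ (M z) ≤ Fintype.card β + 1 := fun z =>
    (Submodule.finrank_add_le_finrank_add_finrank _ _).trans (add_le_add
      ((LinearMap.finrank_range_le _).trans (by simp)) ((finrank_span_le_card {θ}).trans (by simp)))
  let f : (ι → Fin 2) → ℝ := fun x => ‖(M (zhat x)).starProjection (Y x - θ)‖ ^ 2 / 2
  -- The selected `zhat x` depends on the noise; summing over all `z` replaces it by deterministic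
  -- subspaces.
  have hf : ∑ x, bernWeight t x * exp (f x) ≤ Fintype.card Z * 2 ^ (Fintype.card β + 1) := by
    calc ∑ x, bernWeight t x * exp (f x)
        ≤ ∑ x, ∑ z, bernWeight t x * exp (‖(M z).starProjection (Y x - θ)‖ ^ 2 / 2) :=
          Finset.sum_le_sum fun x _ => Finset.single_le_sum
            (f := fun z => bernWeight t x * exp (‖(M z).starProjection (Y x - θ)‖ ^ 2 / 2))
            (fun z _ => mul_nonneg (bernWeight_nonneg ht x) (exp_pos _).le)
            (Finset.mem_univ (zhat x))
      _ = ∑ z, ∑ x, bernWeight t x * exp (‖(M z).starProjection (Y x - θ)‖ ^ 2 / 2) :=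
          Finset.sum_comm
      _ ≤ ∑ z : Z, (2 : ℝ) ^ (Fintype.card β + 1) := Finset.sum_le_sum fun z _ =>
          (sum_bernWeight_exp_proj_le ht (M z)).trans
            (pow_le_pow_right₀ (by norm_num) (hM z))
      _ = _ := by simp
  have hlog := sum_mul_le_log (bernWeight_nonneg ht) (sum_bernWeight t) hf
  have hcard : (Fintype.card Z : ℝ) ≠ 0 := by exact_mod_cast Fintype.card_ne_zero
  rw [log_mul hcard (by positivity), log_pow] at hlog
  have hl2 : log 2 ≤ 1 := by linarith [log_two_lt_d9]
  have hdim : ((Fintype.card β + 1 : ℕ) : ℝ) * log 2 ≤ Fintype.card β + 1 := by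
    push_cast
    exact mul_le_of_le_one_right (by positivity) hl2
  have hpt : ∀ x, ∑ p, ((L (zhat x)).starProjection (Y x) p - t p) ^ 2 ≤ 8 * f x := by
    intro x
    have h := norm_sub_sq_le_of_norm_sub_le (M (zhat x)) (y := Y x) (θ := θ)
      (u := (L (zhat x)).starProjection (Y x))
      (Submodule.mem_sup_left (Submodule.starProjection_apply_mem _ _))
      (Submodule.mem_sup_right (Submodule.mem_span_singleton_self θ))
      ((hzhat x z₀).trans (norm_sub_starProjection_le _ _ hθL))
    rw [EuclideanSpace.norm_sq_eq] at h
    simp only [f]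
    refine le_trans (le_of_eq ?_) (h.trans (by linarith))
    simp [hθ]
  calc ∑ x, bernWeight t x * ∑ p, ((L (zhat x)).starProjection (Y x) p - t p) ^ 2
      ≤ ∑ x, bernWeight t x * (8 * f x) := Finset.sum_le_sum fun x _ =>
        mul_le_mul_of_nonneg_left (hpt x) (bernWeight_nonneg ht x)
    _ = 8 * ∑ x, bernWeight t x * f x := by
        rw [Finset.mul_sum]
        exact Finset.sum_congr rfl fun x _ => by ring
    _ ≤ _ := by linarith

theorem minimaxRisk_le_rate {n k : ℕ} (hn : 2 ≤ n) (hk : 1 ≤ k) :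
    minimaxRisk n k ≤ ENNReal.ofReal (32 * ((k : ℝ) ^ 2 / (n : ℝ) ^ 2 + log k / n)) := by
  have : NeZero k := ⟨by omega⟩
  -- The symmetry of `Q` is ignored: ordered pairs of labels give dimension `k ^ 2`, which is enough
  -- up to a constant.
  obtain ⟨est, hest⟩ := exists_estimator_sum_sq_le
    (fun (z : Fin n → Fin k) (p : Pairs n) => (z p.1.1, z p.1.2))
  have hn0 : (0 : ℝ) < n := by positivity
  have hk1 : (1 : ℝ) ≤ k := by exact_mod_cast hk
  refine (minimaxRisk_le est fun θ hθ => hest _ (fun p => (θ p.1.1 p.1.2).2) ?_).trans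
    (ENNReal.ofReal_le_ofReal ?_)
  · obtain ⟨-, Q, z, -, hz⟩ := hθ
    exact ⟨z, fun a => Q a.1 a.2, fun p => by rw [hz _ _ p.2.ne']⟩
  · simp only [Fintype.card_fun, Fintype.card_fin, Fintype.card_prod, Nat.cast_pow, log_pow,
      Nat.cast_mul]
    have h0 := log_nonneg hk1
    have h1 : n * log k + (k * k + 1) ≤ 2 * (k ^ 2 + n * log k) := by nlinarith
    calc 2 / (n : ℝ) ^ 2 * (8 * (n * log k + (k * k + 1)))
        ≤ 2 / (n : ℝ) ^ 2 * (8 * (2 * (k ^ 2 + n * log k))) := by gcongr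
      _ = _ := by field_simp; ring

/-! ### Lower bound machinery: from indistinguishability to risk -/

section

variable {ι H : Type*} [Fintype ι] [DecidableEq ι] [Fintype H]

/-- The total mass collected by a selection rule `ψ` among product Bernoulli laws that agree off
`T` and are `δ`-close to fair coins on `T`, bounded through the chi-square divergences. -/
theorem sq_sum_bernWeight_selection_le {t : H → ι → ℝ} (ht : ∀ h p, t h p ∈ Set.Icc (0 : ℝ) 1)
    (T : Finset ι) {δ : ℝ} (hT : ∀ h, ∀ p ∈ T, (t h p - 1 / 2) ^ 2 ≤ δ ^ 2)
    (hT' : ∀ h h', ∀ p ∉ T, t h p = t h' p) (ψ : (ι → Fin 2) → H) :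
    (∑ x, bernWeight (t (ψ x)) x) ^ 2 ≤ Fintype.card H * (1 + 4 * δ ^ 2) ^ T.card := by
  let h₀ : H := ψ 0
  let q : ℝ → Fin 2 → ℝ := fun u v => if v = 1 then u else 1 - u
  -- Common reference law: fair coins on `T`. Off `T` all hypotheses agree, so the choice of `h₀` is
  -- immaterial.
  let t₀ : ι → ℝ := fun p => if p ∈ T then 1 / 2 else t h₀ p
  have ht₀ : ∀ p, t₀ p ∈ Set.Icc (0 : ℝ) 1 := fun p => by
    by_cases hp : p ∈ T
    · simp only [t₀, if_pos hp]; norm_num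
    · simpa only [t₀, if_neg hp] using ht h₀ p
  have hq : ∀ u ∈ Set.Icc (0 : ℝ) 1, ∀ v, 0 ≤ q u v := fun u hu v => by
    simp only [q]; split_ifs
    · exact hu.1
    · linarith [hu.2]
  let F : H → (ι → Fin 2) → ℝ := fun h x => ∏ p, q (t h p) (x p) ^ 2 / q (t₀ p) (x p)
  have hF : ∀ h x, 0 ≤ F h x := fun h x =>
    Finset.prod_nonneg fun p _ => div_nonneg (sq_nonneg _) (hq _ (ht₀ p) _)
  have hFw : ∀ h x, bernWeight (t h) x ^ 2 = F h x * bernWeight t₀ x := by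
    intro h x
    simp only [F, bernWeight, ← Finset.prod_mul_distrib, ← Finset.prod_pow]
    refine Finset.prod_congr rfl fun p _ => ?_
    change q (t h p) (x p) ^ 2 = q (t h p) (x p) ^ 2 / q (t₀ p) (x p) * q (t₀ p) (x p)
    -- A reference weight can vanish only off `T`, where the numerator vanishes too, so the
    -- convention `a / 0 = 0` loses nothing.
    by_cases h0 : q (t₀ p) (x p) = 0
    · have hp : p ∉ T := fun hp => by
        simp only [t₀, if_pos hp, q] at h0
        split_ifs at h0 <;> norm_num at h0
      simp only [t₀, if_neg hp] at h0 ⊢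
      rw [hT' h h₀ p hp, h0]
      simp
    · rw [div_mul_cancel₀ _ h0]
  have hsumF : ∀ h, ∑ x, F h x ≤ (1 + 4 * δ ^ 2) ^ T.card := by
    intro h
    simp only [F]
    rw [sum_prod_fin_two (fun p v => q (t h p) v ^ 2 / q (t₀ p) v)]
    calc ∏ p, (q (t h p) 0 ^ 2 / q (t₀ p) 0 + q (t h p) 1 ^ 2 / q (t₀ p) 1)
        ≤ ∏ p, if p ∈ T then 1 + 4 * δ ^ 2 else 1 := by
          refine Finset.prod_le_prod (fun p _ => ?_) fun p _ => ?_
          · exact add_nonneg (div_nonneg (sq_nonneg _) (hq _ (ht₀ p) _))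
              (div_nonneg (sq_nonneg _) (hq _ (ht₀ p) _))
          · by_cases hp : p ∈ T
            · simp only [t₀, q, if_pos hp, Fin.isValue, zero_ne_one, if_false, if_true]
              linarith [hT h p hp, show (1 - t h p) ^ 2 / (1 - 1 / 2) + t h p ^ 2 / (1 / 2) =
                1 + 4 * (t h p - 1 / 2) ^ 2 by ring]
            · simp only [t₀, q, if_neg hp, Fin.isValue, zero_ne_one, if_false, if_true,
                hT' h h₀ p hp, sq, mul_self_div_self]
              linarith
      _ = (1 + 4 * δ ^ 2) ^ T.card := by
          rw [Finset.prod_ite_mem, Finset.univ_inter, Finset.prod_const]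
  calc (∑ x, bernWeight (t (ψ x)) x) ^ 2
      ≤ (∑ x, F (ψ x) x) * ∑ x, bernWeight t₀ x :=
        Finset.sum_sq_le_sum_mul_sum_of_sq_le_mul _ (fun x _ => hF _ x)
          (fun x _ => bernWeight_nonneg ht₀ x) fun x _ => (hFw _ x).le
    _ = ∑ x, F (ψ x) x := by rw [sum_bernWeight, mul_one]
    _ ≤ ∑ x, ∑ h, F h x := Finset.sum_le_sum fun x _ =>
        Finset.single_le_sum (f := fun h => F h x) (fun h _ => hF h x) (Finset.mem_univ _)
    _ = ∑ h, ∑ x, F h x := Finset.sum_comm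
    _ ≤ ∑ _h : H, (1 + 4 * δ ^ 2) ^ T.card := Finset.sum_le_sum fun h _ => hsumF h
    _ = _ := by simp

/-- The Bayes risk for the uniform prior on `s`-separated hypotheses that are hard to tell
apart. -/
theorem le_sum_risk_of_separated [Nonempty H] {t : H → ι → ℝ}
    (ht : ∀ h p, t h p ∈ Set.Icc (0 : ℝ) 1)
    (S T : Finset ι) {δ s : ℝ} (hT : ∀ h, ∀ p ∈ T, (t h p - 1 / 2) ^ 2 ≤ δ ^ 2)
    (hT' : ∀ h h', ∀ p ∉ T, t h p = t h' p) (hs : 0 ≤ s)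
    (hS : ∀ h h', h ≠ h' → s ≤ ∑ p ∈ S, (t h p - t h' p) ^ 2)
    (hδ : (1 + 4 * δ ^ 2) ^ T.card ≤ 81 / 100 * Fintype.card H) (est : (ι → Fin 2) → ι → ℝ) :
    Fintype.card H * (s / 40) ≤
      ∑ h, ∑ x, bernWeight (t h) x * ∑ p ∈ S, (est x p - t h p) ^ 2 := by
  have hmin : ∀ x, ∃ h, ∀ h', ∑ p ∈ S, (est x p - t h p) ^ 2 ≤ ∑ p ∈ S, (est x p - t h' p) ^ 2 :=
    fun x => by
      simpa using Finset.exists_min_image Finset.univ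
        (fun h => ∑ p ∈ S, (est x p - t h p) ^ 2) Finset.univ_nonempty
  choose ψ hψ using hmin
  -- `ψ x` is the hypothesis nearest to the estimate; by separation every other one is at squared
  -- distance at least `s / 4`.
  have hfar : ∀ x h, h ≠ ψ x → s / 4 ≤ ∑ p ∈ S, (est x p - t h p) ^ 2 := by
    intro x h hne
    have h1 : ∑ p ∈ S, (t h p - t (ψ x) p) ^ 2 ≤
        2 * ∑ p ∈ S, (est x p - t h p) ^ 2 + 2 * ∑ p ∈ S, (est x p - t (ψ x) p) ^ 2 := by
      rw [Finset.mul_sum, Finset.mul_sum, ← Finset.sum_add_distrib]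
      refine Finset.sum_le_sum fun p _ => ?_
      nlinarith [sq_nonneg ((est x p - t h p) + (est x p - t (ψ x) p))]
    linarith [hS h (ψ x) hne, hψ x h]
  have hpt : ∀ x, s / 4 * (∑ h, bernWeight (t h) x - bernWeight (t (ψ x)) x) ≤
      ∑ h, bernWeight (t h) x * ∑ p ∈ S, (est x p - t h p) ^ 2 := by
    intro x
    classical
    rw [← Finset.add_sum_erase _ _ (Finset.mem_univ (ψ x)), add_sub_cancel_left,
      ← Finset.add_sum_erase _ (fun h => bernWeight (t h) x * ∑ p ∈ S, (est x p - t h p) ^ 2)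
        (Finset.mem_univ (ψ x)), Finset.mul_sum]
    refine le_add_of_nonneg_of_le (mul_nonneg (bernWeight_nonneg (ht _) x)
      (Finset.sum_nonneg fun p _ => sq_nonneg _)) (Finset.sum_le_sum fun h hh => ?_)
    rw [mul_comm]
    exact mul_le_mul_of_nonneg_left (hfar x h (Finset.ne_of_mem_erase hh))
      (bernWeight_nonneg (ht _) x)
  have hsel := sq_sum_bernWeight_selection_le ht T hT hT' ψ
  have hcard : (0 : ℝ) < Fintype.card H := by exact_mod_cast Fintype.card_pos
  -- The nearest-hypothesis rule is right with average probability at most `9 / 10`; the remaining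
  -- tenth, at cost `s / 4`, gives `s / 40`.
  have hsel' : ∑ x, bernWeight (t (ψ x)) x ≤ 9 / 10 * Fintype.card H := by
    refine le_of_sq_le_sq ?_ (by positivity)
    refine hsel.trans ((mul_le_mul_of_nonneg_left hδ hcard.le).trans (le_of_eq ?_))
    ring
  rw [Finset.sum_comm]
  refine le_trans ?_ (Finset.sum_le_sum fun x _ => hpt x)
  rw [← Finset.mul_sum, Finset.sum_sub_distrib, Finset.sum_comm]
  simp only [sum_bernWeight, Finset.sum_const, Finset.card_univ, nsmul_eq_mul, mul_one]
  nlinarith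

/-- Resampling one letter preserves the uniform average over words, so each letter can be treated
with the others frozen. -/
theorem sum_sum_update {κ : Type*} [Fintype κ] [DecidableEq κ] (c : κ) (g : (κ → H) → ℝ) :
    ∑ σ : κ → H, ∑ h, g (Function.update σ c h) = Fintype.card H * ∑ σ, g σ := by
  have hinv : Function.Involutive
      fun y : (κ → H) × H => (Function.update y.1 c y.2, y.1 c) := fun y => by simp
  rw [← Fintype.sum_prod_type' (f := fun σ h => g (Function.update σ c h))]
  have := Equiv.sum_comp hinv.toPerm fun y : (κ → H) × H => g y.1
  simp only [Function.Involutive.coe_toPerm] at this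
  rw [this, Fintype.sum_prod_type]
  simp [Finset.mul_sum]

/-- A lower bound for the worst risk over a family indexed by words `σ : κ → H`, when the part of
the loss over `S c` forces the estimator to identify the letter `σ c`. -/
theorem exists_le_risk_of_word_family {κ : Type*} [Fintype κ] [DecidableEq κ] [Nonempty H]
    {t : (κ → H) → ι → ℝ} (ht : ∀ σ p, t σ p ∈ Set.Icc (0 : ℝ) 1) (S T : κ → Finset ι)
    {δ s : κ → ℝ} (hT : ∀ σ c, ∀ p ∈ T c, (t σ p - 1 / 2) ^ 2 ≤ δ c ^ 2)
    (hT' : ∀ σ c h, ∀ p ∉ T c, t (Function.update σ c h) p = t σ p) (hs : ∀ c, 0 ≤ s c)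
    (hS : ∀ σ c h h', h ≠ h' → s c ≤
      ∑ p ∈ S c, (t (Function.update σ c h) p - t (Function.update σ c h') p) ^ 2)
    (hdisj : Pairwise fun c c' => Disjoint (S c) (S c'))
    (hδ : ∀ c, (1 + 4 * δ c ^ 2) ^ (T c).card ≤ 81 / 100 * Fintype.card H)
    (est : (ι → Fin 2) → ι → ℝ) :
    ∃ σ, (∑ c, s c) / 40 ≤ ∑ x, bernWeight (t σ) x * ∑ p, (est x p - t σ p) ^ 2 := by
  let R : κ → (κ → H) → ℝ := fun c σ => ∑ x, bernWeight (t σ) x * ∑ p ∈ S c, (est x p - t σ p) ^ 2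
  have hcard : (0 : ℝ) < Fintype.card H := by exact_mod_cast Fintype.card_pos
  have hR : ∀ c, ∑ _σ : κ → H, s c / 40 ≤ ∑ σ, R c σ := by
    intro c
    have h1 : ∑ _σ : κ → H, Fintype.card H * (s c / 40) ≤ Fintype.card H * ∑ σ, R c σ := by
      rw [← sum_sum_update c]
      refine Finset.sum_le_sum fun σ _ => ?_
      exact le_sum_risk_of_separated (fun h => ht _) (S c) (T c) (fun h => hT _ c)
        (fun h h' p hp => by rw [hT' σ c h p hp, hT' σ c h' p hp]) (hs c) (hS σ c) (hδ c) est
    rw [← Finset.mul_sum] at h1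
    exact le_of_mul_le_mul_left h1 hcard
  have hle : ∀ σ, ∑ c, R c σ ≤ ∑ x, bernWeight (t σ) x * ∑ p, (est x p - t σ p) ^ 2 := by
    intro σ
    simp only [R]
    rw [Finset.sum_comm]
    refine Finset.sum_le_sum fun x _ => ?_
    rw [← Finset.mul_sum, ← Finset.sum_biUnion fun c _ c' _ h => hdisj h]
    exact mul_le_mul_of_nonneg_left (Finset.sum_le_sum_of_subset_of_nonneg
      (Finset.subset_univ _) fun p _ _ => sq_nonneg _) (bernWeight_nonneg (ht σ) x)
  have htot : ∑ _σ : κ → H, (∑ c, s c) / 40 ≤ ∑ σ, ∑ c, R c σ := by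
    rw [Finset.sum_comm (f := fun σ c => R c σ)]
    simp only [Finset.sum_div]
    rw [Finset.sum_comm]
    exact Finset.sum_le_sum fun c _ => hR c
  obtain ⟨σ, -, hσ⟩ := Finset.exists_le_of_sum_le Finset.univ_nonempty htot
  exact ⟨σ, hσ.trans (hle σ)⟩

end

theorem le_minimaxRisk_of_block_model {n k : ℕ} {v : ℝ}
    (h : ∀ est : (Pairs n → Fin 2) → Pairs n → ℝ, ∃ (Q : Fin k → Fin k → ℝ) (z : Fin n → Fin k),
      (∀ a b, Q a b ∈ Set.Icc (0 : ℝ) 1) ∧ (∀ a b, Q a b = Q b a) ∧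
      v ≤ ∑ x, bernWeight (fun p : Pairs n => Q (z p.1.1) (z p.1.2)) x *
        ∑ p, (est x p - Q (z p.1.1) (z p.1.2)) ^ 2) :
    ENNReal.ofReal (1 / (n : ℝ) ^ 2 * v) ≤ minimaxRisk n k := by
  refine le_minimaxRisk fun est => ?_
  obtain ⟨Q, z, hQ, hsymm, hv⟩ := h est
  let θ : Matrix (Fin n) (Fin n) unitInterval :=
    Matrix.of fun i j => if i = j then 0 else ⟨Q (z i) (z j), hQ _ _⟩
  have hθ : ∀ p : Pairs n, (θ p.1.1 p.1.2 : ℝ) = Q (z p.1.1) (z p.1.2) := fun p => by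
    simp [θ, p.2.ne']
  refine ⟨θ, ⟨fun i => by simp [θ], Matrix.of fun a b => ⟨Q a b, hQ a b⟩, z,
    fun a b => Subtype.ext (hsymm a b), fun i j hij => by simp [θ, hij]⟩, ?_⟩
  simpa only [hθ] using hv

/-! ### The `k ^ 2` lower bound: unknown block signs -/

theorem one_add_pow_le_exp {a : ℝ} (ha : 0 ≤ a) (m : ℕ) : (1 + a) ^ m ≤ exp (m * a) := by
  rw [Real.exp_nat_mul]
  gcongr
  linarith [add_one_le_exp a]

/-- Some `k`-block assignment of `n` nodes realizes a quarter of `k ^ 2` blocks. -/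
theorem exists_assignment_card_blocks {n k : ℕ} (hn : 2 ≤ n) (hk : 1 ≤ k) (hkn : k ≤ n) :
    ∃ z : Fin n → Fin k, (k : ℝ) ^ 2 / 4 ≤
      (Finset.univ.image fun p : Pairs n => s(z p.1.1, z p.1.2)).card := by
  -- Each of the first `k` nodes gets its own label, and all further nodes get the last one.
  let z : Fin n → Fin k := fun i => ⟨min i (k - 1), by omega⟩
  have hz : ∀ a : Fin k, z (Fin.castLE hkn a) = a := fun a => by
    ext
    simp [z]
    omega
  refine ⟨z, ?_⟩
  set B := Finset.univ.image fun p : Pairs n => s(z p.1.1, z p.1.2) with hB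
  have h1 : Fintype.card (Pairs k) ≤ B.card := by
    rw [← Finset.card_univ]
    refine Finset.card_le_card_of_injOn (fun p => s(p.1.1, p.1.2)) (fun p _ => ?_) ?_
    · rw [hB]
      simp only [Finset.coe_image, Finset.coe_univ, Set.image_univ, Set.mem_range]
      exact ⟨⟨(Fin.castLE hkn p.1.1, Fin.castLE hkn p.1.2), p.2⟩, by simp [hz]⟩
    · rintro ⟨⟨a, b⟩, hab⟩ - ⟨⟨c, d⟩, hcd⟩ - h
      simp only [Sym2.eq_iff] at h hab hcd
      rcases h with ⟨rfl, rfl⟩ | ⟨rfl, rfl⟩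
      · rfl
      · exact absurd hab hcd.not_gt
  -- Needed for `k = 1`, where there are no pairs of distinct labels; `n ≥ 2` provides one realized
  -- block.
  have h2 : 1 ≤ B.card := by
    rw [Nat.one_le_iff_ne_zero, Finset.card_ne_zero, hB, Finset.image_nonempty]
    exact ⟨⟨(⟨1, by omega⟩, ⟨0, by omega⟩), by simp⟩, Finset.mem_univ _⟩
  have h3 := two_mul_card_pairs k
  have h1' : (Fintype.card (Pairs k) : ℝ) ≤ B.card := by exact_mod_cast h1
  have h2' : (1 : ℝ) ≤ B.card := by exact_mod_cast h2
  rcases hk.eq_or_lt with rfl | hk2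
  · norm_num; linarith
  · have : (2 : ℝ) ≤ k := by exact_mod_cast hk2
    nlinarith

/-- The nonparametric part of the lower bound: the unknown signs of the block connectivities. -/
theorem sq_div_sq_le_minimaxRisk {n k : ℕ} (hn : 2 ≤ n) (hk : 1 ≤ k) (hkn : k ≤ n) :
    ENNReal.ofReal (((k : ℝ) ^ 2 / (n : ℝ) ^ 2) / 640) ≤ minimaxRisk n k := by
  obtain ⟨z, hz⟩ := exists_assignment_card_blocks hn hk hkn
  let b : Pairs n → Sym2 (Fin k) := fun p => s(z p.1.1, z p.1.2)
  let S : Sym2 (Fin k) → Finset (Pairs n) := fun c => Finset.univ.filter fun p => b p = c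
  -- Chosen so that `(S c).card * δ c ^ 2 = 1 / 16` on every nonempty block. On an empty block `δ c
  -- = 0`, as division by zero gives zero.
  let δ : Sym2 (Fin k) → ℝ := fun c => 1 / (4 * √(S c).card)
  let s : Sym2 (Fin k) → ℝ := fun c => if c ∈ Finset.univ.image b then 1 / 4 else 0
  let sgn : Fin 2 → ℝ := fun v => if v = 1 then 1 else -1
  have hsgn : ∀ v, sgn v ^ 2 = 1 := fun v => by simp only [sgn]; split_ifs <;> norm_num
  have hsgn2 : ∀ v w, v ≠ w → (sgn v - sgn w) ^ 2 = 4 := by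
    intro v w hvw
    fin_cases v <;> fin_cases w <;> simp [sgn] at hvw ⊢ <;> norm_num
  have hδ2 : ∀ c, (S c).card * δ c ^ 2 = if c ∈ Finset.univ.image b then 1 / 16 else 0 := by
    intro c
    have hmem : c ∈ Finset.univ.image b ↔ (S c).card ≠ 0 := by
      rw [Finset.card_ne_zero]
      simp [S, Finset.filter_nonempty_iff]
    simp only [δ, div_pow, mul_pow, Real.sq_sqrt (Nat.cast_nonneg _)]
    split_ifs with h
    · have : ((S c).card : ℝ) ≠ 0 := by exact_mod_cast hmem.1 h
      field_simp
      norm_num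
    · have : (S c).card = 0 := by simpa using mt hmem.2 h
      simp [this]
  have hδ0 : ∀ c, δ c ^ 2 ≤ 1 / 16 := by
    intro c
    simp only [δ, div_pow, mul_pow, Real.sq_sqrt (Nat.cast_nonneg _)]
    rcases Nat.eq_zero_or_pos (S c).card with h | h
    · simp [h]
    · have : (1 : ℝ) ≤ (S c).card := by exact_mod_cast h
      rw [div_le_div_iff₀ (by positivity) (by norm_num)]
      linarith
  let Q : (Sym2 (Fin k) → Fin 2) → Fin k → Fin k → ℝ :=
    fun σ a b => 1 / 2 + sgn (σ s(a, b)) * δ s(a, b)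
  have hQ : ∀ σ a b, Q σ a b ∈ Set.Icc (0 : ℝ) 1 := by
    intro σ a b
    have h : (sgn (σ s(a, b)) * δ s(a, b)) ^ 2 ≤ (1 / 4) ^ 2 := by
      rw [mul_pow, hsgn, one_mul]
      exact (hδ0 _).trans (by norm_num)
    have h' := abs_le.1 (abs_le_of_sq_le_sq h (by norm_num))
    simp only [Q]
    constructor <;> linarith [h'.1, h'.2]
  have hsum : ∑ c, s c = (Finset.univ.image b).card / 4 := by
    simp only [s]
    rw [Finset.sum_ite_mem, Finset.univ_inter, Finset.sum_const, nsmul_eq_mul]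
    ring
  refine le_trans (ENNReal.ofReal_le_ofReal ?_)
    (le_minimaxRisk_of_block_model (v := (∑ c, s c) / 40) fun est => ?_)
  · rw [hsum]
    have : (k : ℝ) ^ 2 / 640 ≤ (Finset.univ.image b).card / 4 / 40 := by linarith
    calc ((k : ℝ) ^ 2 / (n : ℝ) ^ 2) / 640 = 1 / (n : ℝ) ^ 2 * ((k : ℝ) ^ 2 / 640) := by ring
      _ ≤ _ := by gcongr
  · refine Exists.elim (exists_le_risk_of_word_family (H := Fin 2)
      (t := fun σ (p : Pairs n) => Q σ (z p.1.1) (z p.1.2)) (fun σ p => hQ σ _ _) S S (δ := δ)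
      (s := s) ?_ ?_ ?_ ?_ ?_ ?_ est) fun σ hσ => ?_
    · intro σ c p hp
      obtain rfl : b p = c := by simpa [S] using hp
      simp only [Q, add_sub_cancel_left, mul_pow, hsgn, one_mul]
      exact le_rfl
    · intro σ c h p hp
      have hp' : b p ≠ c := by simpa [S] using hp
      simp only [Q]
      rw [Function.update_of_ne hp']
    · intro c
      simp only [s]
      split_ifs <;> norm_num
    · intro σ c h h' hne
      have : ∀ p ∈ S c, (Q (Function.update σ c h) (z p.1.1) (z p.1.2) -
          Q (Function.update σ c h') (z p.1.1) (z p.1.2)) ^ 2 = 4 * δ c ^ 2 := by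
        intro p hp
        have hp' : s(z p.1.1, z p.1.2) = c := by simpa [S, b] using hp
        simp only [Q, hp', Function.update_self]
        rw [← hsgn2 h h' hne]
        ring
      rw [Finset.sum_congr rfl this, Finset.sum_const, nsmul_eq_mul]
      have := hδ2 c
      simp only [s]
      split_ifs at this ⊢ <;> linarith
    · intro c c' hne
      rw [Finset.disjoint_left]
      intro p hp hp'
      simp only [S, Finset.mem_filter, Finset.mem_univ, true_and] at hp hp'
      exact hne (hp.symm.trans hp')
    · intro c
      -- The left side is at most `exp (1 / 4) ≤ 4 / 3`, below `81 / 100 * 2`.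
      refine (one_add_pow_le_exp (by positivity) _).trans ?_
      have h1 : (S c).card * (4 * δ c ^ 2) ≤ 1 / 4 := by
        have := hδ2 c
        split_ifs at this <;> linarith
      have h2 : exp (1 / 4 : ℝ) ≤ 4 / 3 := by
        have h3 := add_one_le_exp (-(1 / 4 : ℝ))
        rw [exp_neg, ← one_div, le_div_iff₀ (exp_pos _)] at h3
        linarith
      refine (exp_le_exp.2 h1).trans (h2.trans ?_)
      simp only [Fintype.card_fin]
      norm_num
    · exact ⟨Q σ, z, hQ σ, fun a b => by simp only [Q, Sym2.eq_swap], hσ⟩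

/-! ### The `log k` lower bound: unknown labels and Hadamard rows -/

/-- The entries of the Sylvester-Hadamard matrix indexed by binary words. -/
noncomputable def walsh {m : ℕ} (x y : Fin m → Fin 2) : ℝ :=
  ∏ i, if x i = 1 ∧ y i = 1 then -1 else 1

theorem walsh_comm {m : ℕ} (x y : Fin m → Fin 2) : walsh x y = walsh y x := by
  simp only [walsh, and_comm]

theorem walsh_sq {m : ℕ} (x y : Fin m → Fin 2) : walsh x y ^ 2 = 1 := by
  simp only [walsh, ← Finset.prod_pow]
  refine Finset.prod_eq_one fun i _ => ?_
  split_ifs <;> norm_num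

theorem sum_walsh_mul_walsh {m : ℕ} {x x' : Fin m → Fin 2} (h : x ≠ x') :
    ∑ y, walsh x y * walsh x' y = 0 := by
  simp only [walsh, ← Finset.prod_mul_distrib]
  rw [sum_prod_fin_two (fun i v => (if x i = 1 ∧ v = 1 then (-1 : ℝ) else 1) *
    if x' i = 1 ∧ v = 1 then -1 else 1)]
  obtain ⟨i, hi⟩ := Function.ne_iff.1 h
  refine Finset.prod_eq_zero (Finset.mem_univ i) ?_
  rcases Fin.exists_fin_two.1 ⟨x i, rfl⟩ with h1 | h1 <;>
    rcases Fin.exists_fin_two.1 ⟨x' i, rfl⟩ with h2 | h2 <;> simp_all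

theorem sum_sub_walsh_sq {m : ℕ} {x x' : Fin m → Fin 2} (h : x ≠ x') :
    ∑ y, (walsh x y - walsh x' y) ^ 2 = 2 * 2 ^ m := by
  have h1 : ∀ y, (walsh x y - walsh x' y) ^ 2 = 2 - 2 * (walsh x y * walsh x' y) := fun y => by
    linear_combination walsh_sq x y + walsh_sq x' y
  simp only [h1, Finset.sum_sub_distrib, ← Finset.mul_sum, sum_walsh_mul_walsh h]
  simp [mul_comm]

theorem sum_range_mul_mod (F : ℕ → ℝ) (M q : ℕ) :
    ∑ j ∈ Finset.range (M * q), F (j % M) = q * ∑ a ∈ Finset.range M, F a := by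
  induction q with
  | zero => simp
  | succ q ih =>
    rw [Nat.mul_succ, Finset.sum_range_add, ih]
    have : ∀ j ∈ Finset.range M, F ((M * q + j) % M) = F j := fun j hj => by
      rw [Nat.mul_add_mod, Nat.mod_eq_of_lt (Finset.mem_range.1 hj)]
    rw [Finset.sum_congr rfl this]
    push_cast
    ring

theorem card_pairs_containing_le {n : ℕ} (c : Fin n) :
    (Finset.univ.filter fun p : Pairs n => p.1.1 = c ∨ p.1.2 = c).card ≤ 2 * n := by
  have h1 : (Finset.univ.filter fun p : Pairs n => p.1.1 = c).card ≤ n := by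
    conv_rhs => rw [← Fintype.card_fin n, ← Finset.card_univ]
    refine Finset.card_le_card_of_injOn (fun p => p.1.2) (fun _ _ => Finset.mem_univ _) ?_
    intro p hp p' hp' h
    simp only [Finset.coe_filter, Finset.mem_univ, true_and, Set.mem_ofPred_eq] at hp hp'
    exact Subtype.ext (Prod.ext (hp.trans hp'.symm) h)
  have h2 : (Finset.univ.filter fun p : Pairs n => p.1.2 = c).card ≤ n := by
    conv_rhs => rw [← Fintype.card_fin n, ← Finset.card_univ]
    refine Finset.card_le_card_of_injOn (fun p => p.1.1) (fun _ _ => Finset.mem_univ _) ?_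
    intro p hp p' hp' h
    simp only [Finset.coe_filter, Finset.mem_univ, true_and, Set.mem_ofPred_eq] at hp hp'
    exact Subtype.ext (Prod.ext h (hp.trans hp'.symm))
  rw [Finset.filter_or]
  exact (Finset.card_union_le _ _).trans (by omega)

/-- The clustering lower bound with `2 ^ m` labels: the first `2 ^ m * q` nodes carry known
balanced labels, the other nodes carry unknown ones. -/
theorem le_minimaxRisk_of_labels {n k m q : ℕ} (hm : 1 ≤ m) (hk : 2 ^ m ≤ k)
    (hq : 2 ^ m * q ≤ n) (hmn : 2 ^ m ≤ n) :
    ENNReal.ofReal (1 / (n : ℝ) ^ 2 * ((((n - 2 ^ m * q : ℕ) : ℝ) *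
      (2 * (2 ^ m * q) * (log (2 ^ m) / (16 * n)))) / 40)) ≤ minimaxRisk n k := by
  set M := 2 ^ m with hM
  set L := M * q with hL
  have hM2 : 2 ≤ M := by simpa using Nat.pow_le_pow_right (n := 2) (by norm_num) hm
  have hM2' : (2 : ℝ) ≤ M := by exact_mod_cast hM2
  have hMr : ((2 : ℝ) ^ m) = M := by simp [hM]
  have hn0 : (0 : ℝ) < n := by
    have : 0 < n := by omega
    exact_mod_cast this
  have hlog0 : 0 ≤ log M := log_nonneg (by linarith)
  have hlogn : log M ≤ n := by
    refine (log_le_sub_one_of_pos (by linarith)).trans ?_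
    have : (M : ℝ) ≤ n := by exact_mod_cast hmn
    linarith
  rw [hMr]
  -- A label affects at most `2 * n` pairs, so its chi-square exponent is at most `2 * n * (4 * δ ^
  -- 2) = log M / 2`.
  set δ : ℝ := √(log M / (16 * n)) with hδ
  have hδ2 : δ ^ 2 = log M / (16 * n) := Real.sq_sqrt (by positivity)
  have hδle : δ ^ 2 ≤ 1 / 16 := by
    rw [hδ2, div_le_div_iff₀ (by positivity) (by norm_num)]
    linarith
  let H := Fin m → Fin 2
  have hcardH : Fintype.card H = M := by simp [H, hM]
  let e : Fin M ≃ H := (Fintype.equivFinOfCardEq hcardH).symm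
  let emb : H → Fin k := fun h => Fin.castLE hk (e.symm h)
  have hemb : Function.Injective emb := (Fin.castLE_injective hk).comp e.symm.injective
  let r : Fin k → H := Function.invFun emb
  have hr : ∀ h, r (emb h) = h := Function.leftInverse_invFun hemb
  let Q : Fin k → Fin k → ℝ := fun a b => 1 / 2 + walsh (r a) (r b) * δ
  -- The known labels run cyclically through all words, each occurring `q` times, so distances
  -- between rows are `q` times Hadamard row distances.
  let known : ℕ → H := fun j => e ⟨j % M, Nat.mod_lt _ (by omega)⟩
  let lab : (Fin (n - L) → H) → Fin n → H := fun σ i =>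
    if h : L ≤ i then σ ⟨i - L, by omega⟩ else known i
  let node : Fin (n - L) → Fin n := fun c => ⟨L + c, by omega⟩
  have hlab : ∀ σ c, lab σ (node c) = σ c := fun σ c => by
    simp only [lab, node]
    rw [dif_pos (by omega)]
    congr 1
    ext
    simp
  have hlab' : ∀ σ c h i, i ≠ node c → lab (Function.update σ c h) i = lab σ i := by
    intro σ c h i hi
    simp only [lab]
    split_ifs with hLi
    · refine Function.update_of_ne ?_ _ _
      rintro rfl
      exact hi (Fin.ext (by simp [node]; omega))
    · rfl
  let J : Fin (n - L) → Fin L ↪ Pairs n := fun c =>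
    ⟨fun j => ⟨(node c, ⟨j, by omega⟩), Fin.lt_def.2 (by simp [node]; omega)⟩, fun j j' h => by
      simpa [Fin.ext_iff] using h⟩
  have hJ1 : ∀ c j, (J c j).1.1 = node c := fun c j => rfl
  have hJ2 : ∀ c j, ((J c j).1.2 : ℕ) = j := fun c j => rfl
  -- `S c` keeps only the pairs of `node c` with known nodes, which makes the `S c` disjoint. `T c`
  -- must hold every pair affected by the label of `node c`, including those with other unknown
  -- nodes.
  let S : Fin (n - L) → Finset (Pairs n) := fun c => Finset.univ.map (J c)
  let T : Fin (n - L) → Finset (Pairs n) := fun c =>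
    Finset.univ.filter fun p => p.1.1 = node c ∨ p.1.2 = node c
  have hQ : ∀ a b, Q a b ∈ Set.Icc (0 : ℝ) 1 := by
    intro a b
    have h : (walsh (r a) (r b) * δ) ^ 2 ≤ (1 / 4) ^ 2 := by
      rw [mul_pow, walsh_sq, one_mul]
      exact hδle.trans (by norm_num)
    have h' := abs_le.1 (abs_le_of_sq_le_sq h (by norm_num))
    simp only [Q]
    constructor <;> linarith [h'.1, h'.2]
  have hval : ∀ σ (p : Pairs n), Q (emb (lab σ p.1.1)) (emb (lab σ p.1.2)) =
      1 / 2 + walsh (lab σ p.1.1) (lab σ p.1.2) * δ := fun σ p => by simp only [Q, hr]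
  let s : Fin (n - L) → ℝ := fun _ => 2 * (M * q) * (log M / (16 * n))
  have hsum : ∑ c, s c = ((n - L : ℕ) : ℝ) * (2 * (M * q) * (log M / (16 * n))) := by simp [s]
  rw [← hsum]
  refine le_minimaxRisk_of_block_model fun est => ?_
  refine Exists.elim (exists_le_risk_of_word_family (H := H)
    (t := fun σ (p : Pairs n) => Q (emb (lab σ p.1.1)) (emb (lab σ p.1.2))) (fun σ p => hQ _ _) S T
    (δ := fun _ => δ) (s := s) ?_ ?_ ?_ ?_ ?_ ?_ est) fun σ hσ => ?_
  · intro σ c p _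
    simp only [hval, add_sub_cancel_left, mul_pow, walsh_sq, one_mul]
    exact le_rfl
  · intro σ c h p hp
    simp only [T, Finset.mem_filter, Finset.mem_univ, true_and, not_or] at hp
    rw [hlab' σ c h _ hp.1, hlab' σ c h _ hp.2]
  · intro c
    positivity
  · intro σ c h h' hne
    have hterm : ∀ j : Fin L, (1 / 2 + walsh (lab (Function.update σ c h) (J c j).1.1)
        (lab (Function.update σ c h) (J c j).1.2) * δ -
        (1 / 2 + walsh (lab (Function.update σ c h') (J c j).1.1)
        (lab (Function.update σ c h') (J c j).1.2) * δ)) ^ 2 =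
        δ ^ 2 * (walsh h (known j) - walsh h' (known j)) ^ 2 := by
      intro j
      have h1 : ∀ g, lab (Function.update σ c g) (J c j).1.1 = g := fun g => by
        rw [hJ1, hlab, Function.update_self]
      have h2 : ∀ g, lab (Function.update σ c g) (J c j).1.2 = known j := fun g => by
        simp only [lab, hJ2]
        exact dif_neg (by simp)
      rw [h1, h1, h2, h2]
      ring
    simp only [S, Finset.sum_map, hval, hterm, ← Finset.mul_sum]
    have h3 : ∑ j : Fin L, (walsh h (known j) - walsh h' (known j)) ^ 2 = 2 * (M * q) := by
      rw [Fin.sum_univ_eq_sum_range (fun j => (walsh h (known j) - walsh h' (known j)) ^ 2)]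
      have h4 : ∀ j, known j = known (j % M) := fun j => by simp [known]
      have h5 := sum_range_mul_mod (fun j => (walsh h (known j) - walsh h' (known j)) ^ 2) M q
      simp only [← h4] at h5
      rw [h5, ← Fin.sum_univ_eq_sum_range (fun j => (walsh h (known j) - walsh h' (known j)) ^ 2)]
      have h6 : ∀ a : Fin M, known a = e a := fun a => by
        simp [known, Nat.mod_eq_of_lt a.2]
      simp only [h6]
      rw [Equiv.sum_comp e fun y => (walsh h y - walsh h' y) ^ 2, sum_sub_walsh_sq hne, hMr]
      ring
    rw [h3, hδ2]
    simp only [s]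
    linarith
  · intro c c' hne
    rw [Finset.disjoint_left]
    intro p hp hp'
    simp only [S, Finset.mem_map, Finset.mem_univ, true_and] at hp hp'
    obtain ⟨j, rfl⟩ := hp
    obtain ⟨j', hj'⟩ := hp'
    have h1 := congrArg (fun p : Pairs n => (p.1.1 : ℕ)) hj'
    simp only [hJ1, node] at h1
    exact hne (Fin.ext (by omega))
  · intro c
    refine (one_add_pow_le_exp (by positivity) _).trans ?_
    have h1 : ((T c).card : ℝ) ≤ 2 * n := by exact_mod_cast card_pairs_containing_le (node c)
    have h2 : (T c).card * (4 * δ ^ 2) ≤ log M / 2 := by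
      calc (T c).card * (4 * δ ^ 2) ≤ 2 * n * (4 * δ ^ 2) := by gcongr
        _ = log M / 2 := by rw [hδ2]; field_simp; ring
    refine (exp_le_exp.2 h2).trans ?_
    rw [hcardH]
    have h3 : exp (log M / 2) ^ 2 = M := by
      rw [← Real.exp_nat_mul, Nat.cast_two, mul_div_cancel₀ _ two_ne_zero, exp_log (by linarith)]
    -- `√M ≥ √2 > 1.24 > 100 / 81`, whence `√M ≤ 81 / 100 * M`.
    have h4 : (1.24 : ℝ) ≤ exp (log M / 2) := by
      refine le_of_sq_le_sq ?_ (exp_pos _).le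
      rw [h3]
      linarith
    nlinarith
  · exact ⟨Q, fun i => emb (lab σ i), hQ, fun a b => by simp only [Q, walsh_comm], hσ⟩

/-- The clustering part of the lower bound. -/
theorem log_div_le_minimaxRisk {n k : ℕ} (hk : 2 ≤ k) (hkn : 2 * k ≤ n) :
    ENNReal.ofReal ((log k / n) / 7680) ≤ minimaxRisk n k := by
  set m := Nat.log 2 k with hm
  have hm1 : 1 ≤ m := Nat.log_pos (by norm_num) hk
  have hMk : 2 ^ m ≤ k := Nat.pow_log_le_self 2 (by omega)
  -- Rounding `k` down to a power of two at most halves its logarithm, since `m ≥ 1`.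
  have hkM : k < 2 ^ (m + 1) := Nat.lt_pow_succ_log_self (by norm_num) k
  set q := (n / 2) / 2 ^ m with hq
  have hM0 : 0 < 2 ^ m := by positivity
  have hqle : 2 ^ m * q ≤ n / 2 := Nat.mul_div_le _ _
  have hqlt : n / 2 < 2 ^ m * q + 2 ^ m := Nat.lt_mul_div_succ _ hM0
  -- Here `2 * k ≤ n` is used: one full cycle of labels fits into half of the nodes.
  have hq1 : 1 ≤ q := (Nat.one_le_div_iff hM0).2 (by omega)
  have hqM : 2 ^ m ≤ 2 ^ m * q := Nat.le_mul_of_pos_right _ hq1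
  refine le_trans (ENNReal.ofReal_le_ofReal ?_)
    (le_minimaxRisk_of_labels (q := q) hm1 hMk (by omega) (by omega))
  have hn0 : (0 : ℝ) < n := by
    have : 0 < n := by omega
    exact_mod_cast this
  have h1 : (n : ℝ) / 2 ≤ ((n - 2 ^ m * q : ℕ) : ℝ) := by
    rw [div_le_iff₀ (by norm_num)]
    exact_mod_cast (by omega : n ≤ (n - 2 ^ m * q) * 2)
  have h2 : (n : ℝ) / 6 ≤ (2 : ℝ) ^ m * q := by
    rw [div_le_iff₀ (by norm_num)]
    exact_mod_cast (by omega : n ≤ 2 ^ m * q * 6)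
  have h3 : log k / 2 ≤ log ((2 : ℝ) ^ m) := by
    have h4 : log k ≤ log ((2 : ℝ) ^ (m + 1)) :=
      log_le_log (by positivity) (by exact_mod_cast hkM.le)
    have h5 : (1 : ℝ) ≤ m := by exact_mod_cast hm1
    rw [log_pow] at h4 ⊢
    push_cast at h4
    nlinarith [log_pos (by norm_num : (1 : ℝ) < 2)]
  have hk0 : 0 ≤ log k := log_nonneg (by exact_mod_cast (by omega : 1 ≤ k))
  calc (log k / n) / 7680
      = 1 / (n : ℝ) ^ 2 * (((n / 2) * (2 * (n / 6) * ((log k / 2) / (16 * n)))) / 40) := by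
        field_simp
        ring
    _ ≤ _ := by gcongr

end SBM

/-! ### Combination of the bounds -/

theorem theorem1p1 :
    ∃ C : ℝ, 0 < C ∧ ∀ n k : ℕ, 2 ≤ n → 1 ≤ k → k ≤ n →
      ENNReal.ofReal (C⁻¹ * ((k : ℝ) ^ 2 / (n : ℝ) ^ 2 + Real.log k / n)) ≤ SBM.minimaxRisk n k ∧
      SBM.minimaxRisk n k ≤ ENNReal.ofReal (C * ((k : ℝ) ^ 2 / (n : ℝ) ^ 2 + Real.log k / n)) := by
  -- `15360 = 2 * 7680`: the larger of the two terms is at least half of their sum.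
  refine ⟨15360, by norm_num, fun n k hn hk hkn => ⟨?_, ?_⟩⟩
  · have hn0 : (0 : ℝ) < n := by positivity
    have hA : 0 ≤ (k : ℝ) ^ 2 / (n : ℝ) ^ 2 := by positivity
    have hlow := SBM.sq_div_sq_le_minimaxRisk hn hk hkn
    by_cases hcase : 2 ≤ k ∧ 2 * k ≤ n
    · rcases le_total ((k : ℝ) ^ 2 / (n : ℝ) ^ 2) (Real.log k / n) with h | h
      · exact (ENNReal.ofReal_le_ofReal (by linarith)).trans
          (SBM.log_div_le_minimaxRisk hcase.1 hcase.2)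
      · exact (ENNReal.ofReal_le_ofReal (by linarith)).trans hlow
    -- Outside the clustering regime the logarithmic term is dominated: it is zero for `k = 1`, and
    -- otherwise `k > n / 2` makes `k ^ 2 / n ^ 2` of order one.
    · have hB : Real.log k / n ≤ 4 * ((k : ℝ) ^ 2 / (n : ℝ) ^ 2) := by
        rcases hk.eq_or_lt with rfl | hk2
        · simp
        · have h1 : n ≤ 2 * k := by omega
          have h1' : (n : ℝ) ≤ 2 * k := by exact_mod_cast h1
          have hkn' : (k : ℝ) ≤ n := by exact_mod_cast hkn
          have hk0 : (0 : ℝ) < k := by positivity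
          have h2 : Real.log k / n ≤ 1 := by
            rw [div_le_one hn0]
            linarith [Real.log_le_sub_one_of_pos hk0]
          have h3 : 1 ≤ 4 * ((k : ℝ) ^ 2 / (n : ℝ) ^ 2) := by
            rw [← mul_div_assoc, one_le_div (by positivity)]
            nlinarith
          linarith
      exact (ENNReal.ofReal_le_ofReal (by linarith)).trans hlow
  · have h0 : 0 ≤ (k : ℝ) ^ 2 / (n : ℝ) ^ 2 + Real.log k / n := by
      have := Real.log_natCast_nonneg k
      positivity
    refine (SBM.minimaxRisk_le_rate hn hk).trans (ENNReal.ofReal_le_ofReal ?_)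
    linarith
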